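/- Let $d\in\mathbb{N}$, let $M\ge 1$ be an integer, put $\mathcal X=\mathbb{R}^d$ (with its Borel sets) and $\mathcal Y=\{1,\dots,M\}$, and let $(X,Y)$ be a random pair with an arbitrary law $\mu=\mu_{X,Y}$ on $\mathcal X\times\mathcal Y$. For a random variable $U$ with values in a standard Borel space, let $I(U;Y)=H(Y)-H(Y|U)$, where $H(Y)=-\sum_{y}\mathbb P(Y=y)\log \mathbb P(Y=y)$ and $H(Y|U)$ is the integral, over the law of $U$, of the Shannon entropy of the conditional law of $Y$ given $U=u$. For a measurable encoder $\eta:\mathcal X\to\mathbb{R}$ let $I(X;Y|\eta(X))=\int \mathcal I(\mu_{X,Y|\eta(X)=u})\,d\mu_{\eta(X)}(u)$ be the conditional mutual information, where $\mathcal I(\nu)$ is the mutual information of a pair with law $\nu$; let $H(\eta(X))\in[0,\infty]$ be the Shannon entropy of $\eta(X)$, equal to $\infty$ if $\eta(X)$ is not discrete. For $B>0$, a solution $\eta^B$ of the deterministic information bottleneck problem is a measurable $\eta:\mathcal X\to\mathbb{R}$ with $H(\eta(X))\le B$ that maximizes $I(\eta(X);Y)$ among all measurable encoders $\mathcal X\to\mathbb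 R$ with $H(\eta(X))\le B$. Then for every model $\mu_{X,Y}$ and every $\epsilon>0$ there is $B(\epsilon,\mu_{X,Y})>0$ such that for every $B\ge B(\epsilon,\mu_{X,Y})$ and every solution $\eta^B$ of the problem with restriction $B$, $$I(X;Y|\eta^B(X))<\epsilon .$$ In particular, if $\eta^B$ is a solution for each $B>0$, then $\lim_{B\to\infty} I(X;Y|\eta^B(X))=0$. -/

import Mathlib

open MeasureTheory ProbabilityTheory Filter Topology
open scoped ENNReal

/-- Shannon entropy (in nats) of a probability `ν` on the finite alphabet `Fin M`:
`- ∑ y, ν {y} * log (ν {y})`, with `0 * log 0 = 0`. -/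
noncomputable def labelEntropy {M : ℕ} (ν : Measure (Fin M)) : ℝ :=
  ∑ y : Fin M, Real.negMulLog (ν.real {y})

open Classical in
/-- Shannon entropy (in nats) of a probability `ν` on the real line, with values in `[0, ∞]`:
`- ∑ u, ν {u} * log (ν {u})` if `ν` is discrete (carried by a countable set),
and `∞` otherwise. -/
noncomputable def shannonEntropy (ν : Measure ℝ) : ℝ≥0∞ :=
  if ∃ S : Set ℝ, S.Countable ∧ ν Sᶜ = 0 then
    ∑' u : ℝ, ENNReal.ofReal (Real.negMulLog (ν.real {u}))
  else ∞

/-- Conditional entropy `H(Y|Z)` of a joint law `ρ` of `(Z, Y)`: the integral over `z`, with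
respect to the law of `Z`, of the entropy of the conditional law of `Y` given `Z = z`. -/
noncomputable def condEntropy {𝒵 : Type*} [MeasurableSpace 𝒵] {M : ℕ} [NeZero M]
    (ρ : Measure (𝒵 × Fin M)) [IsFiniteMeasure ρ] : ℝ :=
  ∫ z, labelEntropy (ρ.condKernel z) ∂ρ.fst

/-- Mutual information `I(Z;Y) = H(Y) - H(Y|Z)` of a joint law `ρ` of `(Z, Y)`. -/
noncomputable def mutualInfo {𝒵 : Type*} [MeasurableSpace 𝒵] {M : ℕ} [NeZero M]
    (ρ : Measure (𝒵 × Fin M)) [IsFiniteMeasure ρ] : ℝ :=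
  labelEntropy ρ.snd - condEntropy ρ

/-- `I(η(X);Y)` when `(X, Y)` has law `μ`: the mutual information of the law of `(η(X), Y)`. -/
noncomputable def encodedInfo {𝒳 : Type*} [MeasurableSpace 𝒳] {M : ℕ} [NeZero M]
    (μ : Measure (𝒳 × Fin M)) [IsFiniteMeasure μ] (η : 𝒳 → ℝ) : ℝ :=
  mutualInfo (μ.map (fun p => (η p.1, p.2)))

/-- The conditional law of `(X, Y)` given `η(X) = u`, as a Markov kernel in `u`,
when `(X, Y)` has law `μ`. -/
noncomputable def condJoint {𝒳 : Type*} [MeasurableSpace 𝒳] [StandardBorelSpace 𝒳] [Nonempty 𝒳]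
    {M : ℕ} [NeZero M] (μ : Measure (𝒳 × Fin M)) [IsFiniteMeasure μ] (η : 𝒳 → ℝ) :
    Kernel ℝ (𝒳 × Fin M) :=
  condDistrib (fun p => p) (fun p => η p.1) μ

instance condJoint_isMarkovKernel {𝒳 : Type*} [MeasurableSpace 𝒳] [StandardBorelSpace 𝒳] [Nonempty 𝒳]
    {M : ℕ} [NeZero M] (μ : Measure (𝒳 × Fin M)) [IsFiniteMeasure μ] (η : 𝒳 → ℝ) :
    IsMarkovKernel (condJoint μ η) := by
  unfold condJoint; infer_instance

/-- Conditional mutual information `I(X;Y|η(X))` when `(X, Y)` has law `μ`: the integral over `u`,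
with respect to the law of `η(X)`, of the mutual information of the conditional law of `(X, Y)`
given `η(X) = u`. -/
noncomputable def condMutualInfo {𝒳 : Type*} [MeasurableSpace 𝒳] [StandardBorelSpace 𝒳]
    [Nonempty 𝒳] {M : ℕ} [NeZero M] (μ : Measure (𝒳 × Fin M)) [IsFiniteMeasure μ]
    (η : 𝒳 → ℝ) : ℝ :=
  ∫ u, mutualInfo (condJoint μ η u) ∂(μ.map (fun p => η p.1))

/-- `η` solves the deterministic information bottleneck problem with restriction `B` for `μ`: it is
a measurable encoder with `H(η(X)) ≤ B`, and it maximizes `I(η'(X);Y)` among all measurable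
encoders `η'` with `H(η'(X)) ≤ B`. -/
structure IsIBSolution {𝒳 : Type*} [MeasurableSpace 𝒳] {M : ℕ} [NeZero M]
    (μ : Measure (𝒳 × Fin M)) [IsFiniteMeasure μ] (B : ℝ) (η : 𝒳 → ℝ) : Prop where
  measurable : Measurable η
  entropy_le : shannonEntropy (μ.fst.map η) ≤ ENNReal.ofReal B
  isMax : ∀ η' : 𝒳 → ℝ, Measurable η' → shannonEntropy (μ.fst.map η') ≤ ENNReal.ofReal B →
    encodedInfo μ η' ≤ encodedInfo μ η

theorem labelEntropy_mem_Icc {M : ℕ} (ν : Measure (Fin M)) [IsProbabilityMeasure ν] :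
    labelEntropy ν ∈ Set.Icc (0 : ℝ) M := by
  have h : ∀ y : Fin M, 0 ≤ Real.negMulLog (ν.real {y}) ∧ Real.negMulLog (ν.real {y}) ≤ 1 := by
    intro y
    have h0 : 0 ≤ ν.real {y} := measureReal_nonneg
    have h1 : ν.real {y} ≤ 1 := measureReal_le_one
    refine ⟨Real.negMulLog_nonneg h0 h1, ?_⟩
    have := Real.negMulLog_le_one_sub_self h0
    linarith
  refine ⟨Finset.sum_nonneg fun y _ => (h y).1, ?_⟩
  calc labelEntropy ν ≤ ∑ _y : Fin M, (1 : ℝ) := Finset.sum_le_sum fun y _ => (h y).2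
    _ = M := by simp

theorem measurable_labelEntropy {α : Type*} [MeasurableSpace α] {M : ℕ}
    (κ : Kernel α (Fin M)) : Measurable fun a => labelEntropy (κ a) := by
  unfold labelEntropy
  refine Finset.measurable_sum _ fun y _ => ?_
  exact Real.continuous_negMulLog.measurable.comp
    (κ.measurable_coe (MeasurableSet.singleton y)).ennreal_toReal

/-- The integrand in the definition of `condMutualInfo` is integrable, so that the integral has its
usual meaning. -/
theorem integrable_mutualInfo_condJoint {𝒳 : Type*} [MeasurableSpace 𝒳] [StandardBorelSpace 𝒳]
    [Nonempty 𝒳] {M : ℕ} [NeZero M] (μ : Measure (𝒳 × Fin M)) [IsFiniteMeasure μ] (η : 𝒳 → ℝ) :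
    Integrable (fun u => mutualInfo (condJoint μ η u)) (μ.map (fun p => η p.1)) := by
  set κ := condJoint μ η with hκ
  have hc : ∀ u, condEntropy (κ u) = ∫ x, labelEntropy (κ.condKernel (u, x)) ∂(κ.fst u) := by
    intro u
    unfold condEntropy
    rw [Kernel.fst_apply, Measure.fst]
    refine integral_congr_ae ?_
    have := Kernel.condKernel_apply_eq_condKernel κ u
    rw [Kernel.fst_apply] at this
    filter_upwards [this] with x hx
    rw [← hx]
  have hm : Measurable fun u => condEntropy (κ u) := by
    simp_rw [hc]
    have h := (measurable_labelEntropy κ.condKernel).stronglyMeasurable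
    exact (h.integral_kernel_prod_right (κ := κ.fst)
      (f := fun u x => labelEntropy (κ.condKernel (u, x)))).measurable
  have hb : ∀ u, condEntropy (κ u) ∈ Set.Icc (0 : ℝ) M := by
    intro u
    unfold condEntropy
    have hl : ∀ x, labelEntropy ((κ u).condKernel x) ∈ Set.Icc (0 : ℝ) M :=
      fun x => labelEntropy_mem_Icc _
    refine ⟨integral_nonneg fun x => (hl x).1, ?_⟩
    have hi : Integrable (fun x => labelEntropy ((κ u).condKernel x)) (κ u).fst :=
      Integrable.of_bound (measurable_labelEntropy _).aestronglyMeasurable M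
        (ae_of_all _ fun x => by rw [Real.norm_eq_abs, abs_of_nonneg (hl x).1]; exact (hl x).2)
    calc ∫ x, labelEntropy ((κ u).condKernel x) ∂(κ u).fst
        ≤ ∫ _x, (M : ℝ) ∂(κ u).fst := integral_mono hi (integrable_const _) fun x => (hl x).2
      _ = M := by simp
  have hs : Measurable fun u => labelEntropy (κ u).snd := by
    have h := measurable_labelEntropy κ.snd
    simp only [Kernel.snd_apply] at h
    exact h
  have hms : ∀ u, labelEntropy (κ u).snd ∈ Set.Icc (0 : ℝ) M := fun u => labelEntropy_mem_Icc _
  refine Integrable.of_bound (hs.sub hm).aestronglyMeasurable M (ae_of_all _ fun u => ?_)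
  have h1 := hms u
  have h2 := hb u
  change ‖labelEntropy (κ u).snd - condEntropy (κ u)‖ ≤ M
  rw [Real.norm_eq_abs, abs_le]
  exact ⟨by linarith [h1.1, h2.2], by linarith [h1.2, h2.1]⟩

/-!
The chain rule gives `I(X;Y|η(X)) = I(X;Y) - I(η(X);Y)`, so a solution of the bottleneck problem
minimizes `I(X;Y|η(X))` among the encoders admissible at level `B`. It remains to find one encoder
of finite entropy with a small loss, since it is admissible for all large `B`. Rounding the
posterior `x ↦ P(Y=·|X=x)` to a finite net gives one: the posterior given `η(X)` is the conditional
expectation of the posterior given `X`, hence is within twice the rounding error of it, and the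
Shannon entropy is uniformly continuous on laws on a finite alphabet.
-/

section LabelEntropy

variable {α : Type*} [MeasurableSpace α] {M : ℕ}

theorem integrable_labelEntropy (ν : Measure α) [IsFiniteMeasure ν] (κ : Kernel α (Fin M))
    [IsMarkovKernel κ] : Integrable (fun a => labelEntropy (κ a)) ν := by
  refine .of_bound (measurable_labelEntropy κ).aestronglyMeasurable M (ae_of_all _ fun a => ?_)
  obtain ⟨hnonneg, hle⟩ := labelEntropy_mem_Icc (κ a)
  rwa [Real.norm_of_nonneg hnonneg]

theorem integrable_negMulLog_measureReal {β : Type*} [MeasurableSpace β] (ν : Measure α)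
    [IsFiniteMeasure ν] (κ : Kernel α β) [IsMarkovKernel κ] {s : Set β} (hs : MeasurableSet s) :
    Integrable (fun a => Real.negMulLog ((κ a).real s)) ν := by
  refine .of_bound (Real.continuous_negMulLog.measurable.comp
    (κ.measurable_coe hs).ennreal_toReal).aestronglyMeasurable 1 (ae_of_all _ fun a => ?_)
  have hle := Real.negMulLog_le_one_sub_self (measureReal_nonneg (μ := κ a) (s := s))
  rw [Real.norm_of_nonneg (Real.negMulLog_nonneg measureReal_nonneg measureReal_le_one)]
  linarith [measureReal_nonneg (μ := κ a) (s := s)]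

theorem integral_measureReal_eq_comp {β : Type*} [MeasurableSpace β] (ν : Measure α)
    (κ : Kernel α β) [IsFiniteKernel κ] {s : Set β} (hs : MeasurableSet s) :
    ∫ a, (κ a).real s ∂ν = (κ ∘ₘ ν).real s := by
  rw [measureReal_def, Measure.bind_apply hs κ.aemeasurable]
  exact integral_toReal (κ.measurable_coe hs).aemeasurable (ae_of_all _ fun _ => measure_lt_top _ _)

theorem integral_labelEntropy_le_labelEntropy_comp (ν : Measure α) [IsProbabilityMeasure ν]
    (κ : Kernel α (Fin M)) [IsMarkovKernel κ] :
    ∫ a, labelEntropy (κ a) ∂ν ≤ labelEntropy (κ ∘ₘ ν) := by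
  simp only [labelEntropy]
  rw [integral_finsetSum _ fun y _ => integrable_negMulLog_measureReal ν κ (.singleton y)]
  refine Finset.sum_le_sum fun y _ => ?_
  rw [← integral_measureReal_eq_comp ν κ (.singleton y)]
  exact Real.concaveOn_negMulLog.le_map_integral Real.continuous_negMulLog.continuousOn
    isClosed_Ici (ae_of_all _ fun _ => measureReal_nonneg)
    (Kernel.IsMarkovKernel.integrable ν κ (.singleton y))
    (integrable_negMulLog_measureReal ν κ (.singleton y))

theorem exists_forall_abs_labelEntropy_sub_lt (M : ℕ) {ε : ℝ} (hε : 0 < ε) :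
    ∃ δ > 0, ∀ (ν ν' : Measure (Fin M)) [IsProbabilityMeasure ν] [IsProbabilityMeasure ν'],
      (∀ y, |ν.real {y} - ν'.real {y}| < δ) → |labelEntropy ν - labelEntropy ν'| < ε := by
  have huc : UniformContinuousOn Real.negMulLog (Set.Icc 0 1) :=
    isCompact_Icc.uniformContinuousOn_of_continuous Real.continuous_negMulLog.continuousOn
  obtain ⟨δ, hδ, h⟩ := Metric.uniformContinuousOn_iff.1 huc (ε / (M + 1)) (by positivity)
  refine ⟨δ, hδ, fun ν ν' _ _ hνν' => ?_⟩
  calc |labelEntropy ν - labelEntropy ν'|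
      = |∑ y, (Real.negMulLog (ν.real {y}) - Real.negMulLog (ν'.real {y}))| := by
        rw [labelEntropy, labelEntropy, Finset.sum_sub_distrib]
    _ ≤ ∑ _y : Fin M, ε / (M + 1) :=
        (Finset.abs_sum_le_sum_abs _ _).trans <| Finset.sum_le_sum fun y _ =>
          (h _ ⟨measureReal_nonneg, measureReal_le_one⟩ _
            ⟨measureReal_nonneg, measureReal_le_one⟩ (hνν' y)).le
    _ = M * ε / (M + 1) := by simp [mul_div_assoc]
    _ < ε := by rw [div_lt_iff₀ (by positivity)]; linarith

end LabelEntropy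

section CondEntropy

variable {𝒵 : Type*} [MeasurableSpace 𝒵] {M : ℕ} [NeZero M]

theorem condEntropy_of_compProd_eq {ρ : Measure (𝒵 × Fin M)} [IsFiniteMeasure ρ] {ν : Measure 𝒵}
    [IsFiniteMeasure ν] {κ : Kernel 𝒵 (Fin M)} [IsMarkovKernel κ] (h : ν ⊗ₘ κ = ρ) :
    condEntropy ρ = ∫ z, labelEntropy (κ z) ∂ν := by
  subst h
  rw [condEntropy, Measure.fst_compProd]
  refine integral_congr_ae ?_
  filter_upwards [condKernel_compProd ν κ] with z hz
  rw [hz]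

theorem mutualInfo_nonneg (ρ : Measure (𝒵 × Fin M)) [IsProbabilityMeasure ρ] :
    0 ≤ mutualInfo ρ := by
  have hsnd : ρ.snd = ρ.condKernel ∘ₘ ρ.fst := by
    rw [← Measure.snd_compProd, ρ.disintegrate]
  rw [mutualInfo, hsnd, sub_nonneg]
  exact integral_labelEntropy_le_labelEntropy_comp ρ.fst ρ.condKernel

end CondEntropy

theorem condMutualInfo_nonneg {𝒳 : Type*} [MeasurableSpace 𝒳] [StandardBorelSpace 𝒳]
    [Nonempty 𝒳] {M : ℕ} [NeZero M] (μ : Measure (𝒳 × Fin M)) [IsFiniteMeasure μ] (η : 𝒳 → ℝ) :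
    0 ≤ condMutualInfo μ η :=
  integral_nonneg fun u => mutualInfo_nonneg (condJoint μ η u)

section EncodedLaw

variable {𝒳 𝒵 : Type*} [MeasurableSpace 𝒳] [MeasurableSpace 𝒵] {M : ℕ}

/-- The law of `(η(X), Y)` when `(X, Y)` has law `μ`, for an encoder `η` with values in any
measurable space. -/
noncomputable abbrev encodedLaw (μ : Measure (𝒳 × Fin M)) (η : 𝒳 → 𝒵) : Measure (𝒵 × Fin M) :=
  μ.map fun p => (η p.1, p.2)

theorem condKernel_encodedLaw_ae_eq_condExp [NeZero M] (μ : Measure (𝒳 × Fin M))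
    [IsFiniteMeasure μ] {η : 𝒳 → 𝒵} (hη : Measurable η) (y : Fin M) :
    (fun p => ((encodedLaw μ η).condKernel (η p.1)).real {y}) =ᵐ[μ]
      μ⟦Prod.snd ⁻¹' {y} | MeasurableSpace.comap (fun p => η p.1) inferInstance⟧ := by
  simpa only [condDistrib] using condDistrib_ae_eq_condExp (μ := μ) (X := fun p => η p.1)
    (Y := Prod.snd) (hη.comp measurable_fst) measurable_snd (MeasurableSet.singleton y)

theorem condKernel_encodedLaw_ae_eq_condExp_condKernel [NeZero M] (μ : Measure (𝒳 × Fin M))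
    [IsFiniteMeasure μ] {η : 𝒳 → 𝒵} (hη : Measurable η) (y : Fin M) :
    (fun p => ((encodedLaw μ η).condKernel (η p.1)).real {y}) =ᵐ[μ]
      μ[fun p => (μ.condKernel p.1).real {y} |
        MeasurableSpace.comap (fun p => η p.1) inferInstance] := by
  have hX : (fun p : 𝒳 × Fin M => (μ.condKernel p.1).real {y}) =ᵐ[μ]
      μ⟦Prod.snd ⁻¹' {y} | MeasurableSpace.comap (fun p => p.1) inferInstance⟧ := by
    simpa only [encodedLaw, id, Prod.mk.eta, Measure.map_id'] using
      condKernel_encodedLaw_ae_eq_condExp μ measurable_id y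
  have hle : MeasurableSpace.comap (fun p : 𝒳 × Fin M => η p.1) inferInstance ≤
      MeasurableSpace.comap (fun p => p.1) inferInstance :=
    (hη.comp (comap_measurable _)).comap_le
  calc (fun p => ((encodedLaw μ η).condKernel (η p.1)).real {y})
      =ᵐ[μ] _ := condKernel_encodedLaw_ae_eq_condExp μ hη y
    _ =ᵐ[μ] _ := (condExp_condExp_of_le hle measurable_fst.comap_le).symm
    _ =ᵐ[μ] _ := condExp_congr_ae hX.symm

theorem condEntropy_encodedLaw [NeZero M] (μ : Measure (𝒳 × Fin M)) [IsFiniteMeasure μ]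
    {η : 𝒳 → 𝒵} (hη : Measurable η) :
    condEntropy (encodedLaw μ η) =
      ∫ p, labelEntropy ((encodedLaw μ η).condKernel (η p.1)) ∂μ := by
  rw [condEntropy, Measure.fst_map_prodMk measurable_snd,
    integral_map (by fun_prop) (measurable_labelEntropy _).aestronglyMeasurable]

theorem condEntropy_encodedLaw_sub_le [NeZero M] (μ : Measure (𝒳 × Fin M)) [IsFiniteMeasure μ]
    {η : 𝒳 → 𝒵} (hη : Measurable η) {c : ℝ}
    (h : ∀ᵐ p ∂μ, |labelEntropy ((encodedLaw μ η).condKernel (η p.1)) -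
      labelEntropy (μ.condKernel p.1)| ≤ c) :
    condEntropy (encodedLaw μ η) - condEntropy μ ≤ c * μ.real Set.univ := by
  have hX : condEntropy μ = ∫ p, labelEntropy (μ.condKernel p.1) ∂μ := by
    simpa only [encodedLaw, id, Prod.mk.eta, Measure.map_id'] using
      condEntropy_encodedLaw μ measurable_id
  have hη₁ : Measurable fun p : 𝒳 × Fin M => η p.1 := by fun_prop
  have hint := integrable_labelEntropy μ ((encodedLaw μ η).condKernel.comap _ hη₁)
  have hintX := integrable_labelEntropy μ (μ.condKernel.comap Prod.fst measurable_fst)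
  simp only [Kernel.comap_apply] at hint hintX
  rw [condEntropy_encodedLaw μ hη, hX, ← integral_sub hint hintX]
  exact (Real.le_norm_self _).trans (norm_integral_le_of_norm_le_const h)

end EncodedLaw

section ChainRule

theorem map_compProd_eq_map_compProd_comap {α β γ : Type*} [MeasurableSpace α] [MeasurableSpace β]
    [MeasurableSpace γ] (ν : Measure α) [SFinite ν] {f : α → β} (hf : Measurable f)
    (κ : Kernel β γ) [IsSFiniteKernel κ] :
    ν.map f ⊗ₘ κ = (ν ⊗ₘ κ.comap f hf).map (Prod.map f id) := by
  ext s hs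
  have hf' : Measurable (Prod.map f (id : γ → γ)) := hf.prodMap measurable_id
  rw [Measure.compProd_apply hs, lintegral_map (Kernel.measurable_kernel_prodMk_left hs) hf,
    Measure.map_apply hf' hs, Measure.compProd_apply (hf' hs)]
  rfl

variable {𝒳 : Type*} [MeasurableSpace 𝒳] [StandardBorelSpace 𝒳] [Nonempty 𝒳] {M : ℕ} [NeZero M]
  (μ : Measure (𝒳 × Fin M)) [IsFiniteMeasure μ] {η : 𝒳 → ℝ}

theorem compProd_condJoint :
    μ.map (fun p => η p.1) ⊗ₘ condJoint μ η = μ.map fun p => (η p.1, p) :=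
  compProd_map_condDistrib aemeasurable_id

theorem compProd_fst_condJoint (hη : Measurable η) :
    μ.map (fun p => η p.1) ⊗ₘ (condJoint μ η).fst = μ.fst.map fun x => (η x, x) := by
  rw [Kernel.fst_eq, Measure.compProd_map measurable_fst, compProd_condJoint, Measure.fst,
    Measure.map_map (by fun_prop) (by fun_prop), Measure.map_map (by fun_prop) (by fun_prop)]
  rfl

theorem compProd_snd_condJoint (hη : Measurable η) :
    μ.map (fun p => η p.1) ⊗ₘ (condJoint μ η).snd = encodedLaw μ η := by
  rw [Kernel.snd_eq, Measure.compProd_map measurable_snd, compProd_condJoint,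
    Measure.map_map (by fun_prop) (by fun_prop)]
  rfl

theorem fst_condJoint_comp_map (hη : Measurable η) :
    (condJoint μ η).fst ∘ₘ μ.map (fun p => η p.1) = μ.fst := by
  rw [← Measure.snd_compProd, compProd_fst_condJoint μ hη, Measure.snd_map_prodMk hη,
    Measure.map_id']

-- `η(X)` is a function of `X`, so conditioning on it leaves the law of `Y` given `X` unchanged.
theorem ae_fst_condJoint_compProd_condKernel_eq (hη : Measurable η) :
    ∀ᵐ u ∂μ.map (fun p => η p.1),
      (condJoint μ η).fst u ⊗ₘ μ.condKernel = condJoint μ η u := by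
  have hgraph : Measurable fun x => (η x, x) := by fun_prop
  have hdisint : μ.map (fun p => (η p.1, p)) = μ.map (fun p => η p.1) ⊗ₘ
      ((condJoint μ η).fst ⊗ₖ Kernel.prodMkLeft ℝ μ.condKernel) := by
    rw [← Measure.compProd_assoc', compProd_fst_condJoint μ hη,
      map_compProd_eq_map_compProd_comap μ.fst hgraph]
    change _ = ((μ.fst ⊗ₘ μ.condKernel).map _).map _
    rw [μ.disintegrate, Measure.map_map (by fun_prop) (by fun_prop)]
    rfl
  filter_upwards [condDistrib_ae_eq_of_measure_eq_compProd _ aemeasurable_id hdisint] with u hu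
  refine Eq.trans ?_ hu.symm
  rw [Kernel.compProd_apply_eq_compProd_sectR]
  rfl

theorem integral_condEntropy_condJoint (hη : Measurable η) :
    ∫ u, condEntropy (condJoint μ η u) ∂μ.map (fun p => η p.1) = condEntropy μ := by
  have hcond : ∀ᵐ u ∂μ.map (fun p => η p.1), condEntropy (condJoint μ η u) =
      ∫ x, labelEntropy (μ.condKernel x) ∂(condJoint μ η).fst u := by
    filter_upwards [ae_fst_condJoint_compProd_condKernel_eq μ hη] with u hu
    exact condEntropy_of_compProd_eq hu
  rw [integral_congr_ae hcond, condEntropy, ← fst_condJoint_comp_map μ hη,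
    Measure.comp_eq_comp_const_apply, Kernel.integral_comp (integrable_labelEntropy _ _),
    Kernel.const_apply]

theorem condMutualInfo_eq_condEntropy_sub (hη : Measurable η) :
    condMutualInfo μ η = condEntropy (encodedLaw μ η) - condEntropy μ := by
  have hlabel : Integrable (fun u => labelEntropy (condJoint μ η u).snd)
      (μ.map fun p => η p.1) := by
    simpa only [Kernel.snd_apply, Measure.snd] using
      integrable_labelEntropy (μ.map fun p => η p.1) (condJoint μ η).snd
  have hcond : Integrable (fun u => condEntropy (condJoint μ η u)) (μ.map fun p => η p.1) := by
    simpa only [mutualInfo, Pi.sub_def, sub_sub_cancel] using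
      hlabel.sub (integrable_mutualInfo_condJoint μ η)
  rw [condEntropy_of_compProd_eq (compProd_snd_condJoint μ hη),
    ← integral_condEntropy_condJoint μ hη, condMutualInfo]
  simp only [Kernel.snd_apply, mutualInfo]
  exact integral_sub hlabel hcond

theorem condMutualInfo_eq_mutualInfo_sub_encodedInfo (hη : Measurable η) :
    condMutualInfo μ η = mutualInfo μ - encodedInfo μ η := by
  have hsnd : (encodedLaw μ η).snd = μ.snd := Measure.snd_map_prodMk (by fun_prop)
  rw [condMutualInfo_eq_condEntropy_sub μ hη, encodedInfo, mutualInfo, mutualInfo, hsnd]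
  ring

end ChainRule

section Approximation

theorem ae_norm_sub_condExp_le {Ω E : Type*} [NormedAddCommGroup E] [NormedSpace ℝ E]
    [CompleteSpace E] {m m₀ : MeasurableSpace Ω} {μ : Measure Ω} [IsFiniteMeasure μ]
    (hm : m ≤ m₀) {f g : Ω → E} (hf : Integrable f μ) (hg : StronglyMeasurable[m] g) {δ : ℝ}
    (h : ∀ᵐ ω ∂μ, ‖f ω - g ω‖ ≤ δ) : ∀ᵐ ω ∂μ, ‖f ω - (μ[f | m]) ω‖ ≤ 2 * δ := by
  have hfg : Integrable (f - g) μ :=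
    .of_bound (hf.aestronglyMeasurable.sub (hg.mono hm).aestronglyMeasurable) δ h
  have hgi : Integrable g μ := by simpa only [sub_sub_cancel] using hf.sub hfg
  have hcond : ∀ᵐ ω ∂μ, ‖(μ[f | m]) ω - g ω‖ ≤ δ := by
    filter_upwards [condExp_sub hf hgi m, ae_bdd_norm_condExp_of_ae_bdd_norm h] with ω hsub hω
    rw [← Pi.sub_def, hsub, Pi.sub_apply, condExp_of_stronglyMeasurable hm hg hgi] at hω
    exact hω
  filter_upwards [h, hcond] with ω hfω hω
  calc ‖f ω - (μ[f | m]) ω‖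
      ≤ ‖f ω - g ω‖ + ‖g ω - (μ[f | m]) ω‖ := norm_sub_le_norm_sub_add_norm_sub ..
    _ ≤ 2 * δ := by rw [norm_sub_rev (g ω)]; linarith

theorem exists_simpleFunc_dist_lt {α E : Type*} [MeasurableSpace α] [PseudoMetricSpace E]
    [MeasurableSpace E] [OpensMeasurableSpace E] {f : α → E} (hf : Measurable f)
    (hrange : TotallyBounded (Set.range f)) {ε : ℝ} (hε : 0 < ε) :
    ∃ s : SimpleFunc α E, ∀ x, dist (f x) (s x) < ε := by
  cases isEmpty_or_nonempty α
  · exact ⟨.ofIsEmpty, isEmptyElim⟩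
  obtain ⟨t, htfin, hcover⟩ := Metric.totallyBounded_iff.1 hrange ε hε
  have hnet : ∀ x, ∃ y ∈ t, dist (f x) y < ε := fun x => by
    simpa using hcover ⟨x, rfl⟩
  obtain ⟨y₀, hy₀, -⟩ := hnet (Classical.arbitrary α)
  obtain ⟨e, rfl⟩ := htfin.countable.exists_eq_range ⟨y₀, hy₀⟩
  have hindex : ∀ y ∈ Set.range e, ∀ᶠ N in atTop, ∃ k ≤ N, e k = y := by
    rintro _ ⟨k, rfl⟩
    filter_upwards [eventually_ge_atTop k] with N hN using ⟨k, hN, rfl⟩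
  obtain ⟨N, hN⟩ := ((eventually_all_finite htfin).2 hindex).exists
  refine ⟨(SimpleFunc.nearestPt e N).comp f hf, fun x => ?_⟩
  obtain ⟨y, hy, hxy⟩ := hnet x
  obtain ⟨k, hk, rfl⟩ := hN y hy
  have hnear := SimpleFunc.edist_nearestPt_le e (f x) hk
  rw [edist_dist, edist_dist, ENNReal.ofReal_le_ofReal_iff dist_nonneg] at hnear
  rw [SimpleFunc.coe_comp, Function.comp_apply, dist_comm]
  exact hnear.trans_lt (by rwa [dist_comm])

end Approximation

section Quantization

variable {𝒳 : Type*} [MeasurableSpace 𝒳] {M : ℕ} [NeZero M]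
  (μ : Measure (𝒳 × Fin M)) [IsFiniteMeasure μ]

theorem ae_abs_condKernel_encodedLaw_sub_le {𝒵 : Type*} [MeasurableSpace 𝒵] {η : 𝒳 → 𝒵}
    (hη : Measurable η) (y : Fin M) {g : 𝒵 → ℝ} (hg : Measurable g) {δ : ℝ}
    (h : ∀ x, |(μ.condKernel x).real {y} - g (η x)| ≤ δ) :
    ∀ᵐ p ∂μ, |((encodedLaw μ η).condKernel (η p.1)).real {y} -
      (μ.condKernel p.1).real {y}| ≤ 2 * δ := by
  have hint : Integrable (fun p => (μ.condKernel p.1).real {y}) μ :=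
    Kernel.IsMarkovKernel.integrable μ (μ.condKernel.comap Prod.fst measurable_fst) (.singleton y)
  have hη₁ : Measurable fun p : 𝒳 × Fin M => η p.1 := by fun_prop
  filter_upwards [condKernel_encodedLaw_ae_eq_condExp_condKernel μ hη y,
    ae_norm_sub_condExp_le hη₁.comap_le hint (hg.comp (comap_measurable _)).stronglyMeasurable
      (ae_of_all _ fun p => h p.1)] with p hcond hp
  rwa [hcond, abs_sub_comm]

theorem exists_simpleFunc_abs_condKernel_sub_lt {δ : ℝ} (hδ : 0 < δ) :
    ∃ s : SimpleFunc 𝒳 (Fin M → ℝ), ∀ x y, |(μ.condKernel x).real {y} - s x y| < δ := by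
  have hmeas : Measurable fun x (y : Fin M) => (μ.condKernel x).real {y} :=
    measurable_pi_lambda _ fun y => (μ.condKernel.measurable_coe (.singleton y)).ennreal_toReal
  have hrange : TotallyBounded (Set.range fun x (y : Fin M) => (μ.condKernel x).real {y}) :=
    isCompact_Icc.totallyBounded.subset <| Set.range_subset_iff.2 fun x =>
      Set.mem_Icc.2 ⟨fun y => measureReal_nonneg, fun y => measureReal_le_one⟩
  obtain ⟨s, hs⟩ := exists_simpleFunc_dist_lt hmeas hrange hδ
  exact ⟨s, fun x y => (dist_le_pi_dist _ _ y).trans_lt (hs x)⟩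

theorem exists_finite_range_abs_condKernel_encodedLaw_sub_lt {δ : ℝ} (hδ : 0 < δ) :
    ∃ η : 𝒳 → ℝ, Measurable η ∧ (Set.range η).Finite ∧ ∀ᵐ p ∂μ, ∀ y,
      |((encodedLaw μ η).condKernel (η p.1)).real {y} - (μ.condKernel p.1).real {y}| < δ := by
  obtain ⟨s, hs⟩ := exists_simpleFunc_abs_condKernel_sub_lt μ (δ := δ / 3) (by positivity)
  obtain ⟨decode, hdecode, hinv⟩ := (measurableEmbedding_embeddingReal
    (Fin M → ℝ)).exists_measurable_extend measurable_id fun _ => inferInstance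
  have hη : Measurable fun x => embeddingReal (Fin M → ℝ) (s x) :=
    (measurable_embeddingReal _).comp s.measurable
  refine ⟨_, hη, Set.range_comp .. ▸ s.finite_range.image _, ae_all_iff.2 fun y => ?_⟩
  have hclose : ∀ x, |(μ.condKernel x).real {y} -
      decode (embeddingReal _ (s x)) y| ≤ δ / 3 := fun x => by
    have hx : decode (embeddingReal _ (s x)) = s x := congrFun hinv (s x)
    rw [hx]
    exact (hs x y).le
  filter_upwards [ae_abs_condKernel_encodedLaw_sub_le μ hη y
    ((measurable_pi_apply y).comp hdecode) hclose] with p hp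
  exact hp.trans_lt (by linarith)

theorem exists_finite_range_condEntropy_encodedLaw_sub_lt {ε : ℝ} (hε : 0 < ε) :
    ∃ η : 𝒳 → ℝ, Measurable η ∧ (Set.range η).Finite ∧
      condEntropy (encodedLaw μ η) - condEntropy μ < ε := by
  obtain ⟨δ, hδ, hclose⟩ :=
    exists_forall_abs_labelEntropy_sub_lt M (ε := ε / (μ.real Set.univ + 1)) (by positivity)
  obtain ⟨η, hη, hfin, hpost⟩ := exists_finite_range_abs_condKernel_encodedLaw_sub_lt μ hδ
  refine ⟨η, hη, hfin, ?_⟩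
  calc condEntropy (encodedLaw μ η) - condEntropy μ
      ≤ ε / (μ.real Set.univ + 1) * μ.real Set.univ :=
        condEntropy_encodedLaw_sub_le μ hη (hpost.mono fun p hp => (hclose _ _ hp).le)
    _ < ε := by
        rw [div_mul_eq_mul_div, div_lt_iff₀ (by positivity)]
        linarith

end Quantization

theorem shannonEntropy_lt_top_of_finite {ν : Measure ℝ} {S : Set ℝ} (hS : S.Finite)
    (hν : ν Sᶜ = 0) : shannonEntropy ν < ∞ := by
  rw [shannonEntropy, if_pos ⟨S, hS.countable, hν⟩, tsum_eq_sum (s := hS.toFinset)]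
  · exact ENNReal.sum_lt_top.2 fun _ _ => ENNReal.ofReal_lt_top
  · intro u hu
    have hnull : ν {u} = 0 := measure_mono_null (by simpa using hu) hν
    simp [measureReal_def, hnull]

section InformationBottleneck

variable {𝒳 : Type*} [MeasurableSpace 𝒳] [StandardBorelSpace 𝒳] [Nonempty 𝒳] {M : ℕ} [NeZero M]

theorem IsIBSolution.condMutualInfo_le {μ : Measure (𝒳 × Fin M)} [IsFiniteMeasure μ] {B : ℝ}
    {η η' : 𝒳 → ℝ} (hη : IsIBSolution μ B η) (hη' : Measurable η')
    (hB : shannonEntropy (μ.fst.map η') ≤ ENNReal.ofReal B) :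
    condMutualInfo μ η ≤ condMutualInfo μ η' := by
  rw [condMutualInfo_eq_mutualInfo_sub_encodedInfo μ hη.measurable,
    condMutualInfo_eq_mutualInfo_sub_encodedInfo μ hη']
  exact sub_le_sub_left (hη.isMax η' hη' hB) _

theorem exists_condMutualInfo_lt (μ : Measure (𝒳 × Fin M)) [IsFiniteMeasure μ] {ε : ℝ}
    (hε : 0 < ε) : ∃ η : 𝒳 → ℝ, Measurable η ∧ shannonEntropy (μ.fst.map η) < ∞ ∧
      condMutualInfo μ η < ε := by
  obtain ⟨η, hη, hfin, hlt⟩ := exists_finite_range_condEntropy_encodedLaw_sub_lt μ hε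
  refine ⟨η, hη, shannonEntropy_lt_top_of_finite hfin ?_, ?_⟩
  · rw [Measure.map_apply hη hfin.measurableSet.compl, Set.preimage_compl, Set.preimage_range,
      Set.compl_univ, measure_empty]
  · rwa [condMutualInfo_eq_condEntropy_sub μ hη]

theorem exists_forall_isIBSolution_condMutualInfo_lt (μ : Measure (𝒳 × Fin M))
    [IsFiniteMeasure μ] {ε : ℝ} (hε : 0 < ε) :
    ∃ B₀ > 0, ∀ B ≥ B₀, ∀ η : 𝒳 → ℝ, IsIBSolution μ B η → condMutualInfo μ η < ε := by
  obtain ⟨η', hη', htop, hlt⟩ := exists_condMutualInfo_lt μ hε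
  refine ⟨(shannonEntropy (μ.fst.map η')).toReal + 1, by positivity, fun B hB η hη => ?_⟩
  refine (hη.condMutualInfo_le hη' ?_).trans_lt hlt
  rw [← ENNReal.ofReal_toReal htop.ne]
  exact ENNReal.ofReal_le_ofReal ((le_add_of_nonneg_right zero_le_one).trans hB)

end InformationBottleneck

theorem lemma5_general {𝒳 : Type*} [MeasurableSpace 𝒳] [StandardBorelSpace 𝒳] [Nonempty 𝒳]
    {M : ℕ} [NeZero M] (μ : Measure (𝒳 × Fin M)) [IsFiniteMeasure μ] :
    (∀ ε : ℝ, 0 < ε → ∃ B₀ : ℝ, 0 < B₀ ∧ ∀ B : ℝ, B₀ ≤ B →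
      ∀ η : 𝒳 → ℝ, IsIBSolution μ B η → condMutualInfo μ η < ε) ∧
    (∀ η : ℝ → 𝒳 → ℝ, (∀ B : ℝ, 0 < B → IsIBSolution μ B (η B)) →
      Tendsto (fun B => condMutualInfo μ (η B)) atTop (𝓝 0)) := by
  refine ⟨fun ε hε => exists_forall_isIBSolution_condMutualInfo_lt μ hε, fun η hη =>
    Metric.tendsto_atTop.2 fun ε hε => ?_⟩
  obtain ⟨B₀, hB₀, hlt⟩ := exists_forall_isIBSolution_condMutualInfo_lt μ hε
  refine ⟨B₀, fun B hB => ?_⟩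
  rw [Real.dist_0_eq_abs, abs_of_nonneg (condMutualInfo_nonneg μ _)]
  exact hlt B hB (η B) (hη B (hB₀.trans_le hB))

theorem lemma5 {d M : ℕ} [NeZero M] (μ : Measure (EuclideanSpace ℝ (Fin d) × Fin M))
    [IsProbabilityMeasure μ] :
    (∀ ε : ℝ, 0 < ε → ∃ B₀ : ℝ, 0 < B₀ ∧ ∀ B : ℝ, B₀ ≤ B →
      ∀ η : EuclideanSpace ℝ (Fin d) → ℝ, IsIBSolution μ B η → condMutualInfo μ η < ε) ∧
    (∀ η : ℝ → EuclideanSpace ℝ (Fin d) → ℝ, (∀ B : ℝ, 0 < B → IsIBSolution μ B (η B)) →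
      Tendsto (fun B => condMutualInfo μ (η B)) atTop (𝓝 0)) :=
  lemma5_general μ
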